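/- Let $\pi:E\to M$ be a smooth fibred manifold (a surjective submersion, for instance a fibre bundle), $\dim M=n$, $\dim E=n+k$; indices $i,j$ run over $1,\dots,n$ and $A,B$ over $1,\dots,k$, and repeated indices are summed. Let $L_\pi E$ be the adapted frame bundle: its points are $u=(e_i,e_A)_e$, where $e\in E$ and $(e_i,e_A)$ is a basis of $T_eE$ with $\pi_*e_A=0$; it is a smooth manifold, with projection $\lambda(u)=e$, on which the group $G_V$ of invertible block lower triangular matrices $\begin{pmatrix}A&0\\C&B\end{pmatrix}$ acts on the right by $(u\cdot g)_\beta=g^\alpha_\beta\,u_\alpha$. For $\xi$ in the Lie algebra of $G_V$ let $\xi^*(u)=\frac{d}{dt}\big|_{t=0}u\cdot\exp(t\xi)$; in particular $E^{*i}_j,\ E^{*i}_A,\ E^{*A}_B$ are the fundamental vector fields of the elementary matrices $r_i\mapsto r_j$, $r_i\mapsto r_A$, $r_A\mapsto r_B$. Let $\theta^i,\theta^A$ be the components of the soldering form: $\lambda_*X=\theta^i(X)e_i+\theta^A(X)e_A$ for $X\in T_u(L_\pi E)$. Let $L:L_\pi E\to\mathbb R$ be a smooth lifted Lagrangian, i.e.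 $E^{*i}_j(L)=0$ and $E^{*A}_B(L)=0$ for all indices. Its Cartan–Hamilton–Poincaré $1$-forms, with normalisation $\tau(n)=\frac1n$, are $$\theta^i_L=\tfrac1n\,L\,\theta^i+E^{*i}_A(L)\,\theta^A ,\qquad \theta^A_L=\theta^A .$$ Let $\Lambda$ be a contravariant volume on $M$: a nowhere vanishing $n$-vector field that is locally of the form $f_1\wedge\dots\wedge f_n$ with smooth vector fields $f_i$. Let $\sigma:L_\pi E\to\mathbb R$ be defined by $$\pi_*e_1\wedge\dots\wedge\pi_*e_n=\sigma(u)\,\Lambda(\pi(e)),\qquad u=(e_i,e_A)_e .$$ Then $\sigma$ is smooth and nowhere zero, and for every $i=1,\dots,n$ $$\theta^i_L=\frac1\sigma\,d_{\tilde J^i}(\sigma L),\qquad \tilde J^i=\tfrac1n\,E^{*i}_j\otimes\theta^j+E^{*i}_A\otimes\theta^A ,$$ where $d_{\tilde J^i}=[\iota_{\tilde J^i},d]=\iota_{\tilde J^i}d-d\,\iota_{\tilde J^i}$, and $\iota_J$ is the derivation that vanishes on functions and satisfies $(\iota_J\omega)(X)=\omega(JX)$ on $1$-forms. -/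

import Mathlib

open scoped Manifold ContDiff

noncomputable section

namespace CHP

/-! ### Fibred manifolds and the adapted frame bundle (as a set) -/

/-- A smooth fibred manifold `π : E → M` (a surjective submersion), where `dim M = n` and
`dim E = n + k`. Every smooth fibre bundle with `k`-dimensional fibre is one. -/
structure FiberedManifold (n k : ℕ) (E M : Type*)
    [TopologicalSpace E] [ChartedSpace (EuclideanSpace ℝ (Fin (n + k))) E]
    [TopologicalSpace M] [ChartedSpace (EuclideanSpace ℝ (Fin n)) M] where
  /-- the projection `π` -/
  proj : E → M
  surjective : Function.Surjective proj
  submersion : Manifold.IsSubmersion (𝓡 (n + k)) (𝓡 n) ∞ proj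

section

variable {n k : ℕ} {E M : Type*}
    [TopologicalSpace E] [ChartedSpace (EuclideanSpace ℝ (Fin (n + k))) E]
    [TopologicalSpace M] [ChartedSpace (EuclideanSpace ℝ (Fin n)) M]

/-- The adapted frame bundle `L_π E`: its points are the frames `(e_i, e_A)` at points `e` of `E`
(bases of `T_e E`) whose last `k` vectors are vertical, `π_* e_A = 0`. The index `Sum.inl i`
stands for `i`, the index `Sum.inr A` stands for `A`. -/
@[ext]
structure AdaptedFrame (π : FiberedManifold n k E M) where
  /-- the base point `e = λ(u)` -/
  pt : E
  /-- the frame `(e_i, e_A)` of `T_e E` -/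
  frame : Module.Basis (Fin n ⊕ Fin k) ℝ (TangentSpace (𝓡 (n + k)) pt)
  vertical : ∀ A : Fin k, mfderiv (𝓡 (n + k)) (𝓡 n) π.proj pt (frame (Sum.inr A)) = 0

/-! ### The smooth structure of the adapted frame bundle

In adapted coordinates `(x^i, y^A)` of `E`, an adapted frame is given by the coordinates of its base
point, the components `(v^j_i, v^A_i)` of the `e_i`, and the components `v^B_A` of the `e_A`
(the components `v^i_A` vanish). These velocity coordinates are the charts of `L_π E`. -/

/-- The model space of `L_π E`: coordinates `((x^i, y^A), (v^j_i, v^A_i), v^B_A)`. -/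
abbrev Model (n k : ℕ) : Type :=
  (EuclideanSpace ℝ (Fin n) × EuclideanSpace ℝ (Fin k)) ×
    (Fin n → EuclideanSpace ℝ (Fin n) × EuclideanSpace ℝ (Fin k)) ×
    (Fin k → EuclideanSpace ℝ (Fin k))

/-- Adapted coordinates `(x^i, y^A)` on an open subset of `E`: a chart of `E` together with a
chart of `M` such that `π` becomes the projection `(x, y) ↦ x`. -/
structure AdaptedChart (π : FiberedManifold n k E M) where
  dom : OpenPartialHomeomorph E (EuclideanSpace ℝ (Fin (n + k)))
  cod : OpenPartialHomeomorph M (EuclideanSpace ℝ (Fin n))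
  dom_mem : dom ∈ IsManifold.maximalAtlas (𝓡 (n + k)) ∞ E
  cod_mem : cod ∈ IsManifold.maximalAtlas (𝓡 n) ∞ M
  equiv : EuclideanSpace ℝ (Fin (n + k)) ≃L[ℝ]
    (EuclideanSpace ℝ (Fin n) × EuclideanSpace ℝ (Fin k))
  mapsTo : ∀ e ∈ dom.source, π.proj e ∈ cod.source
  proj_eq : ∀ e ∈ dom.source, cod (π.proj e) = (equiv (dom e)).1

namespace AdaptedChart

variable {π : FiberedManifold n k E M}

/-- The coordinate map `e ↦ (x^i(e), y^A(e))`. -/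
def coord (c : AdaptedChart π) (e : E) : EuclideanSpace ℝ (Fin n) × EuclideanSpace ℝ (Fin k) :=
  c.equiv (c.dom e)

/-- The inverse of the coordinate map. -/
def coordInv (c : AdaptedChart π) (z : EuclideanSpace ℝ (Fin n) × EuclideanSpace ℝ (Fin k)) : E :=
  c.dom.symm (c.equiv.symm z)

/-- The differential of the coordinate map: components of tangent vectors of `E`. -/
def D (c : AdaptedChart π) (e : E) :
    TangentSpace (𝓡 (n + k)) e →L[ℝ] EuclideanSpace ℝ (Fin n) × EuclideanSpace ℝ (Fin k) :=
  mfderiv (𝓡 (n + k)) 𝓘(ℝ, EuclideanSpace ℝ (Fin n) × EuclideanSpace ℝ (Fin k)) c.coord e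

/-- The frame of `ℝ^n × ℝ^k` with the given components; the last `k` vectors are vertical. -/
def compFrame (w : Model n k) :
    Fin n ⊕ Fin k → EuclideanSpace ℝ (Fin n) × EuclideanSpace ℝ (Fin k) :=
  Sum.elim w.2.1 (fun A => (0, w.2.2 A))

/-- The velocity coordinates of an adapted frame. -/
def frameCoord (c : AdaptedChart π) (u : AdaptedFrame π) : Model n k :=
  (c.coord u.pt, fun i => c.D u.pt (u.frame (Sum.inl i)),
    fun A => (c.D u.pt (u.frame (Sum.inr A))).2)

/-- The domain of the velocity coordinates: all adapted frames over the domain of the chart. -/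
def frameSource (c : AdaptedChart π) : Set (AdaptedFrame π) := {u | u.pt ∈ c.dom.source}

/-- The range of the velocity coordinates. -/
def frameTarget (c : AdaptedChart π) : Set (Model n k) :=
  {w | c.equiv.symm w.1 ∈ c.dom.target ∧ LinearIndependent ℝ (compFrame w)}

lemma coordInv_coord (c : AdaptedChart π) {e : E} (he : e ∈ c.dom.source) :
    c.coordInv (c.coord e) = e := by
  simp [coordInv, coord, he]

lemma coord_coordInv (c : AdaptedChart π)
    {z : EuclideanSpace ℝ (Fin n) × EuclideanSpace ℝ (Fin k)}
    (hz : c.equiv.symm z ∈ c.dom.target) : c.coord (c.coordInv z) = z := by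
  simp [coordInv, coord, hz]

lemma isOpen_frameTarget (c : AdaptedChart π) : IsOpen c.frameTarget := by
  have h1 : IsOpen {v : Fin n ⊕ Fin k → EuclideanSpace ℝ (Fin n) × EuclideanSpace ℝ (Fin k) |
      LinearIndependent ℝ v} := isOpen_setOfPred_linearIndependent
  have h2 : Continuous (compFrame : Model n k → _) := by
    refine continuous_pi fun a => ?_
    rcases a with i | A
    · exact (continuous_apply i).comp (continuous_fst.comp continuous_snd)
    · exact continuous_const.prodMk
        ((continuous_apply A).comp (continuous_snd.comp continuous_snd))
  exact (c.dom.open_target.preimage (c.equiv.symm.continuous.comp continuous_fst)).inter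
    (h1.preimage h2)

lemma contMDiffOn_coord (c : AdaptedChart π) :
    ContMDiffOn (𝓡 (n + k)) 𝓘(ℝ, EuclideanSpace ℝ (Fin n) × EuclideanSpace ℝ (Fin k)) ∞
      c.coord c.dom.source :=
  c.equiv.contDiff.contMDiff.comp_contMDiffOn (contMDiffOn_of_mem_maximalAtlas c.dom_mem)

lemma contMDiffOn_coordInv (c : AdaptedChart π) :
    ContMDiffOn 𝓘(ℝ, EuclideanSpace ℝ (Fin n) × EuclideanSpace ℝ (Fin k)) (𝓡 (n + k)) ∞
      c.coordInv (c.equiv.symm ⁻¹' c.dom.target) :=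
  (contMDiffOn_symm_of_mem_maximalAtlas c.dom_mem).comp
    c.equiv.symm.contDiff.contMDiff.contMDiffOn (fun _ h => h)

lemma mdifferentiableAt_coord (c : AdaptedChart π) {e : E} (he : e ∈ c.dom.source) :
    MDifferentiableAt (𝓡 (n + k)) 𝓘(ℝ, EuclideanSpace ℝ (Fin n) × EuclideanSpace ℝ (Fin k))
      c.coord e :=
  ((c.contMDiffOn_coord e he).contMDiffAt (c.dom.open_source.mem_nhds he)).mdifferentiableAt
    (by simp)

lemma D_bijective (c : AdaptedChart π) {e : E} (he : e ∈ c.dom.source) :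
    Function.Bijective (c.D e) := by
  have h2 : c.dom.MDifferentiable (𝓡 (n + k)) (𝓡 (n + k)) :=
    ⟨(contMDiffOn_of_mem_maximalAtlas c.dom_mem).mdifferentiableOn (by simp),
      (contMDiffOn_symm_of_mem_maximalAtlas c.dom_mem).mdifferentiableOn (by simp)⟩
  have h1 : HasMFDerivAt (𝓡 (n + k))
      𝓘(ℝ, EuclideanSpace ℝ (Fin n) × EuclideanSpace ℝ (Fin k)) c.coord e _ :=
    (c.equiv.toContinuousLinearMap.hasMFDerivAt (x := c.dom e)).comp e
      (h2.mdifferentiableAt he).hasMFDerivAt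
  have h3 := h2.mfderiv_bijective he
  rw [D, h1.mfderiv]
  exact c.equiv.bijective.comp h3

lemma vertical_iff (c : AdaptedChart π) {e : E} (he : e ∈ c.dom.source)
    (v : TangentSpace (𝓡 (n + k)) e) :
    mfderiv (𝓡 (n + k)) (𝓡 n) π.proj e v = 0 ↔ (c.D e v).1 = 0 := by
  have hπ : MDifferentiableAt (𝓡 (n + k)) (𝓡 n) π.proj e :=
    (π.submersion.contMDiff e).mdifferentiableAt (by simp)
  have hc : c.cod.MDifferentiable (𝓡 n) (𝓡 n) :=
    ⟨(contMDiffOn_of_mem_maximalAtlas c.cod_mem).mdifferentiableOn (by simp),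
      (contMDiffOn_symm_of_mem_maximalAtlas c.cod_mem).mdifferentiableOn (by simp)⟩
  have h1 : HasMFDerivAt (𝓡 (n + k)) (𝓡 n) (c.cod ∘ π.proj) e _ :=
    (hc.mdifferentiableAt (c.mapsTo e he)).hasMFDerivAt.comp e hπ.hasMFDerivAt
  have h2 : HasMFDerivAt (𝓡 (n + k)) 𝓘(ℝ, EuclideanSpace ℝ (Fin n)) (fun e => (c.coord e).1) e _ :=
    ((ContinuousLinearMap.fst ℝ (EuclideanSpace ℝ (Fin n))
      (EuclideanSpace ℝ (Fin k))).hasMFDerivAt (x := c.coord e)).comp e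
      (c.mdifferentiableAt_coord he).hasMFDerivAt
  have h3 : (fun e => (c.coord e).1) =ᶠ[nhds e] c.cod ∘ π.proj :=
    Filter.eventuallyEq_of_mem (c.dom.open_source.mem_nhds he) fun e' he' => (c.proj_eq e' he').symm
  have h4 := hasMFDerivAt_unique h1 (h2.congr_of_eventuallyEq h3.symm)
  have h5 := DFunLike.congr_fun h4 v
  have h6 : mfderiv (𝓡 n) (𝓡 n) c.cod (π.proj e) (mfderiv (𝓡 (n + k)) (𝓡 n) π.proj e v)
      = (c.D e v).1 := h5
  constructor
  · intro h
    rw [← h6, h, map_zero]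
    rfl
  · intro h
    apply hc.mfderiv_injective (c.mapsTo e he)
    rw [h6, h, map_zero]
    rfl

lemma compFrame_frameCoord (c : AdaptedChart π) {u : AdaptedFrame π} (hu : u ∈ c.frameSource) :
    compFrame (c.frameCoord u) = c.D u.pt ∘ u.frame := by
  funext a
  rcases a with i | A
  · rfl
  · have := (c.vertical_iff hu _).1 (u.vertical A)
    exact Prod.ext this.symm rfl

lemma bijOn_frameCoord (c : AdaptedChart π) :
    Set.BijOn c.frameCoord c.frameSource c.frameTarget := by
  refine ⟨fun u hu => ⟨?_, ?_⟩, fun u hu u' hu' h => ?_, fun w hw => ?_⟩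
  · have : u.pt ∈ c.dom.source := hu
    simp [frameCoord, coord, this]
  · rw [c.compFrame_frameCoord hu]
    exact u.frame.linearIndependent.map' (c.D u.pt).toLinearMap
      (LinearMap.ker_eq_bot.2 (c.D_bijective hu).1)
  · have h1 : u.pt = u'.pt := by
      rw [← c.coordInv_coord hu, ← c.coordInv_coord hu']
      exact congrArg c.coordInv (congrArg Prod.fst h)
    have h2 := c.compFrame_frameCoord hu
    rw [h, c.compFrame_frameCoord hu'] at h2
    rcases u with ⟨e, b, hb⟩
    rcases u' with ⟨e', b', hb'⟩
    obtain rfl : e = e' := h1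
    have h3 : b = b' := Module.Basis.eq_of_apply_eq fun a =>
      (c.D_bijective hu).1 (congrFun h2 a).symm
    subst h3
    rfl
  · have he : c.coordInv w.1 ∈ c.dom.source := c.dom.map_target hw.1
    let T : TangentSpace (𝓡 (n + k)) (c.coordInv w.1) ≃ₗ[ℝ]
        (EuclideanSpace ℝ (Fin n) × EuclideanSpace ℝ (Fin k)) :=
      LinearEquiv.ofBijective (c.D (c.coordInv w.1)).toLinearMap (c.D_bijective he)
    have hT : ∀ v, c.D (c.coordInv w.1) (T.symm v) = v := fun v => T.apply_symm_apply v
    let b0 := basisOfLinearIndependentOfCardEqFinrank' (compFrame w) hw.2 (by simp)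
    have hb : ∀ a, (b0.map T.symm) a = T.symm (compFrame w a) := fun a => by simp [b0]
    refine ⟨⟨c.coordInv w.1, b0.map T.symm, fun A => ?_⟩, he, ?_⟩
    · rw [c.vertical_iff he, hb, hT]
      rfl
    · simp only [frameCoord, hb, hT]
      rw [c.coord_coordInv hw.1]
      rfl

/-- The velocity coordinates as a partial bijection (the frame `u₀` only witnesses that `L_π E` is
nonempty, which fixes irrelevant values outside the range of the coordinates). -/
def frameChart (u₀ : AdaptedFrame π) (c : AdaptedChart π) :
    PartialEquiv (AdaptedFrame π) (Model n k) :=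
  haveI : Nonempty (AdaptedFrame π) := ⟨u₀⟩
  Set.BijOn.toPartialEquiv c.frameCoord c.frameSource c.frameTarget c.bijOn_frameCoord

/-- The change of adapted coordinates on `E`. -/
def trans (c c' : AdaptedChart π) (z : EuclideanSpace ℝ (Fin n) × EuclideanSpace ℝ (Fin k)) :
    EuclideanSpace ℝ (Fin n) × EuclideanSpace ℝ (Fin k) :=
  c'.coord (c.coordInv z)

/-- The domain of the change of adapted coordinates on `E`. -/
def transSource (c c' : AdaptedChart π) :
    Set (EuclideanSpace ℝ (Fin n) × EuclideanSpace ℝ (Fin k)) :=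
  c.equiv.symm ⁻¹' c.dom.target ∩ c.coordInv ⁻¹' c'.dom.source

lemma isOpen_transSource (c c' : AdaptedChart π) : IsOpen (transSource c c') :=
  c.contMDiffOn_coordInv.continuousOn.isOpen_inter_preimage
    (c.dom.open_target.preimage c.equiv.symm.continuous) c'.dom.open_source

lemma contDiffOn_trans (c c' : AdaptedChart π) :
    ContDiffOn ℝ ∞ (trans c c') (transSource c c') :=
  contMDiffOn_iff_contDiffOn.1 (c'.contMDiffOn_coord.comp
    (c.contMDiffOn_coordInv.mono Set.inter_subset_left) (fun _ h => h.2))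

lemma D_trans (c c' : AdaptedChart π) {e : E} (he : e ∈ c.dom.source) (he' : e ∈ c'.dom.source)
    (v : TangentSpace (𝓡 (n + k)) e) :
    c'.D e v = fderiv ℝ (trans c c') (c.coord e) (c.D e v) := by
  have hmem : c.coord e ∈ transSource c c' := by
    refine ⟨?_, ?_⟩
    · simp [coord, he]
    · simpa [c.coordInv_coord he] using he'
  have h1 : DifferentiableAt ℝ (trans c c') (c.coord e) :=
    ((contDiffOn_trans c c').contDiffAt ((isOpen_transSource c c').mem_nhds hmem)).differentiableAt
      (by simp)
  have h2 : HasMFDerivAt (𝓡 (n + k))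
      𝓘(ℝ, EuclideanSpace ℝ (Fin n) × EuclideanSpace ℝ (Fin k)) (trans c c' ∘ c.coord) e _ :=
    h1.hasFDerivAt.hasMFDerivAt.comp e (c.mdifferentiableAt_coord he).hasMFDerivAt
  have h3 : c'.coord =ᶠ[nhds e] trans c c' ∘ c.coord :=
    Filter.eventuallyEq_of_mem (c.dom.open_source.mem_nhds he) fun e' he' => by
      simp [trans, c.coordInv_coord he']
  rw [D, (h2.congr_of_eventuallyEq h3).mfderiv]
  rfl

/-- The change of velocity coordinates on `L_π E`. -/
def frameTrans (c c' : AdaptedChart π) (w : Model n k) : Model n k :=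
  (trans c c' w.1, fun i => fderiv ℝ (trans c c') w.1 (w.2.1 i),
    fun A => (fderiv ℝ (trans c c') w.1 (0, w.2.2 A)).2)

lemma frameChart_trans_source (u₀ u₁ : AdaptedFrame π) (c c' : AdaptedChart π) :
    ((frameChart u₀ c).symm.trans (frameChart u₁ c')).source =
      c.frameTarget ∩ Prod.fst ⁻¹' transSource c c' := by
  ext w
  rw [PartialEquiv.trans_source]
  change (w ∈ c.frameTarget ∧ ((frameChart u₀ c).symm w).pt ∈ c'.dom.source) ↔
    (w ∈ c.frameTarget ∧ (c.equiv.symm w.1 ∈ c.dom.target ∧ c.coordInv w.1 ∈ c'.dom.source))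
  refine and_congr_right fun hw => ?_
  have h1 : (frameChart u₀ c).symm w ∈ c.frameSource := (frameChart u₀ c).map_target hw
  have h2 : c.frameCoord ((frameChart u₀ c).symm w) = w := (frameChart u₀ c).right_inv hw
  have h3 : c.coordInv w.1 = ((frameChart u₀ c).symm w).pt := by
    rw [← c.coordInv_coord h1]
    exact congrArg c.coordInv (congrArg Prod.fst h2.symm)
  rw [h3]
  exact ⟨fun h => ⟨hw.1, h⟩, fun h => h.2⟩

lemma frameChart_trans_eqOn (u₀ u₁ : AdaptedFrame π) (c c' : AdaptedChart π) :
    Set.EqOn ((frameChart u₀ c).symm.trans (frameChart u₁ c')) (frameTrans c c')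
      ((frameChart u₀ c).symm.trans (frameChart u₁ c')).source := by
  intro w hw
  have hw1 : w ∈ c.frameTarget := hw.1
  have h1 : (frameChart u₀ c).symm w ∈ c.frameSource := (frameChart u₀ c).map_target hw1
  have h1' : (frameChart u₀ c).symm w ∈ c'.frameSource := hw.2
  have h2 : c.frameCoord ((frameChart u₀ c).symm w) = w := (frameChart u₀ c).right_inv hw1
  change c'.frameCoord ((frameChart u₀ c).symm w) = _
  generalize (frameChart u₀ c).symm w = u at h1 h1' h2
  subst h2
  have hz : (c.frameCoord u).1 = c.coord u.pt := rfl
  refine Prod.ext ?_ (Prod.ext ?_ ?_)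
  · simp [frameTrans, frameCoord, trans, c.coordInv_coord h1]
  · funext i
    exact D_trans c c' h1 h1' _
  · funext A
    have h3 := congrFun (c.compFrame_frameCoord h1) (Sum.inr A)
    change (c'.D u.pt (u.frame (Sum.inr A))).2 =
      (fderiv ℝ (trans c c') (c.coord u.pt) (compFrame (c.frameCoord u) (Sum.inr A))).2
    rw [h3, D_trans c c' h1 h1']
    rfl

lemma contDiffOn_frameTrans (c c' : AdaptedChart π) :
    ContDiffOn ℝ ∞ (frameTrans c c') (Prod.fst ⁻¹' transSource c c') := by
  have h0 : ContDiffOn ℝ ∞ (fun w : Model n k => trans c c' w.1) (Prod.fst ⁻¹' transSource c c') :=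
    (contDiffOn_trans c c').comp contDiff_fst.contDiffOn (fun _ h => h)
  have h1 : ContDiffOn ℝ ∞ (fun w : Model n k => fderiv ℝ (trans c c') w.1)
      (Prod.fst ⁻¹' transSource c c') :=
    ((contDiffOn_trans c c').fderiv_of_isOpen (isOpen_transSource c c') (by simp)).comp
      contDiff_fst.contDiffOn (fun _ h => h)
  refine h0.prodMk (ContDiffOn.prodMk ?_ ?_)
  · refine contDiffOn_pi.2 fun i => h1.clm_apply (ContDiff.contDiffOn ?_)
    fun_prop
  · refine contDiffOn_pi.2 fun A => ContDiff.comp_contDiffOn contDiff_snd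
      (h1.clm_apply (ContDiff.contDiffOn ?_))
    fun_prop

lemma exists_mem_source (π : FiberedManifold n k E M) (e : E) :
    ∃ c : AdaptedChart π, e ∈ c.dom.source := by
  have h := π.submersion.isSubmersionOfComplement_complement e
  have hfin : FiniteDimensional ℝ (EuclideanSpace ℝ (Fin n) × π.submersion.complement) :=
    h.equiv.toLinearEquiv.finiteDimensional
  have hfin' : FiniteDimensional ℝ π.submersion.complement :=
    Module.Finite.of_surjective (LinearMap.snd ℝ (EuclideanSpace ℝ (Fin n)) π.submersion.complement)
      LinearMap.snd_surjective
  have hrank : Module.finrank ℝ π.submersion.complement = k := by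
    have := h.equiv.toLinearEquiv.finrank_eq
    rw [Module.finrank_prod] at this
    simpa using this.symm
  have T : π.submersion.complement ≃L[ℝ] EuclideanSpace ℝ (Fin k) :=
    ContinuousLinearEquiv.ofFinrankEq (by simp [hrank])
  refine ⟨⟨h.domChart, h.codChart, h.domChart_mem_maximalAtlas, h.codChart_mem_maximalAtlas,
    h.equiv.trans ((ContinuousLinearEquiv.refl ℝ _).prodCongr T),
    fun e he => h.source_subset_preimage_source he, fun e he => ?_⟩, h.mem_domChart_source⟩
  have h1 := Manifold.IsSubmersionAtOfComplement.writtenInCharts h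
    (show h.domChart e ∈ (h.domChart.extend (𝓡 (n + k))).target by simp [he])
  simpa [he] using h1

end AdaptedChart

/-- The atlas of velocity coordinates of `L_π E` coming from all adapted coordinates of `E`. -/
def frameAtlas (π : FiberedManifold n k E M) : ChartedSpaceCore (Model n k) (AdaptedFrame π) where
  atlas := {f | ∃ (u₀ : AdaptedFrame π) (c : AdaptedChart π), f = c.frameChart u₀}
  chartAt u := (AdaptedChart.exists_mem_source π u.pt).choose.frameChart u
  mem_chart_source u := (AdaptedChart.exists_mem_source π u.pt).choose_spec
  chart_mem_atlas u := ⟨u, _, rfl⟩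
  open_source := by
    rintro _ _ ⟨u₀, c, rfl⟩ ⟨u₁, c', rfl⟩
    rw [AdaptedChart.frameChart_trans_source]
    exact c.isOpen_frameTarget.inter ((AdaptedChart.isOpen_transSource c c').preimage continuous_fst)
  continuousOn_toFun := by
    rintro _ _ ⟨u₀, c, rfl⟩ ⟨u₁, c', rfl⟩
    refine ContinuousOn.congr ?_ (AdaptedChart.frameChart_trans_eqOn u₀ u₁ c c')
    rw [AdaptedChart.frameChart_trans_source]
    exact (AdaptedChart.contDiffOn_frameTrans c c').continuousOn.mono Set.inter_subset_right

instance (π : FiberedManifold n k E M) : TopologicalSpace (AdaptedFrame π) :=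
  (frameAtlas π).toTopologicalSpace

instance (π : FiberedManifold n k E M) : ChartedSpace (Model n k) (AdaptedFrame π) :=
  (frameAtlas π).toChartedSpace

instance (π : FiberedManifold n k E M) : IsManifold 𝓘(ℝ, Model n k) ∞ (AdaptedFrame π) := by
  refine isManifold_of_contDiffOn _ _ _ fun f f' hf hf' => ?_
  obtain ⟨_, ⟨_, rfl⟩, _, ⟨⟨u₀, c, rfl⟩, rfl⟩, rfl⟩ := hf
  obtain ⟨_, ⟨_, rfl⟩, _, ⟨⟨u₁, c', rfl⟩, rfl⟩, rfl⟩ := hf'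
  have h : ContDiffOn ℝ ∞ ((c.frameChart u₀).symm.trans (c'.frameChart u₁))
      ((c.frameChart u₀).symm.trans (c'.frameChart u₁)).source := by
    refine ContDiffOn.congr ?_ (AdaptedChart.frameChart_trans_eqOn u₀ u₁ c c')
    rw [AdaptedChart.frameChart_trans_source]
    exact (AdaptedChart.contDiffOn_frameTrans c c').mono Set.inter_subset_right
  refine h.mono fun x hx => ?_
  exact hx.1

/-! ### The structure group and fundamental vertical vector fields -/

/-- The structure group `G_V` of `L_π E`: invertible block lower triangular matrices
`(A 0; C B)`. -/
def structureGroup (n k : ℕ) : Subgroup (GL (Fin n ⊕ Fin k) ℝ) where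
  carrier := {g | (g : Matrix (Fin n ⊕ Fin k) (Fin n ⊕ Fin k) ℝ).toBlocks₁₂ = 0}
  one_mem' := by
    ext i A
    simp [Matrix.toBlocks₁₂]
  mul_mem' {g h} hg hh := by
    ext i A
    have hg' : ∀ (i : Fin n) (A : Fin k),
        (g : Matrix (Fin n ⊕ Fin k) (Fin n ⊕ Fin k) ℝ) (Sum.inl i) (Sum.inr A) = 0 :=
      fun i A => congrFun (congrFun hg i) A
    have hh' : ∀ (i : Fin n) (A : Fin k),
        (h : Matrix (Fin n ⊕ Fin k) (Fin n ⊕ Fin k) ℝ) (Sum.inl i) (Sum.inr A) = 0 :=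
      fun i A => congrFun (congrFun hh i) A
    simp [Matrix.toBlocks₁₂, Matrix.mul_apply, hg', hh']
  inv_mem' {g} hg := by
    have h1 : (g : Matrix (Fin n ⊕ Fin k) (Fin n ⊕ Fin k) ℝ).BlockTriangular
        (Sum.elim (fun _ => 1) (fun _ => 0) : Fin n ⊕ Fin k → ℕ) := by
      rintro (i | A) (j | B) h
      · simp at h
      · exact congrFun (congrFun hg i) B
      · simp at h
      · simp at h
    have : Invertible (g : Matrix (Fin n ⊕ Fin k) (Fin n ⊕ Fin k) ℝ) := g.isUnit.invertible
    have h2 := Matrix.blockTriangular_inv_of_blockTriangular h1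
    ext i A
    rw [Matrix.coe_units_inv]
    exact h2 (by simp)

/-- The Lie algebra of `G_V`: all block lower triangular matrices. -/
def structureAlgebra (n k : ℕ) : Submodule ℝ (Matrix (Fin n ⊕ Fin k) (Fin n ⊕ Fin k) ℝ) where
  carrier := {ξ | ξ.toBlocks₁₂ = 0}
  zero_mem' := rfl
  add_mem' {ξ η} hξ hη := by
    ext i A
    have h1 := congrFun (congrFun hξ i) A
    have h2 := congrFun (congrFun hη i) A
    simp only [Matrix.toBlocks₁₂, Matrix.of_apply, Matrix.zero_apply] at h1 h2
    simp [Matrix.toBlocks₁₂, h1, h2]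
  smul_mem' a ξ hξ := by
    ext i A
    have h1 := congrFun (congrFun hξ i) A
    simp only [Matrix.toBlocks₁₂, Matrix.of_apply, Matrix.zero_apply] at h1
    simp [Matrix.toBlocks₁₂, h1]

/-- The exponential map of `G_V` (the matrix exponential). -/
def groupExp (ξ : structureAlgebra n k) : structureGroup n k :=
  ⟨(Matrix.isUnit_exp (ξ : Matrix (Fin n ⊕ Fin k) (Fin n ⊕ Fin k) ℝ)).unit, by
    have h1 : (ξ : Matrix (Fin n ⊕ Fin k) (Fin n ⊕ Fin k) ℝ).BlockTriangular
        (Sum.elim (fun _ => 1) (fun _ => 0) : Fin n ⊕ Fin k → ℕ) := by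
      rintro (i | A) (j | B) h
      · simp at h
      · exact congrFun (congrFun ξ.2 i) B
      · simp at h
      · simp at h
    ext i A
    exact h1.exp (by simp)⟩

/-- The right action of `G_V` on `L_π E`: `(u · g)_β = ∑_α g^α_β u_α`. -/
def AdaptedFrame.act {π : FiberedManifold n k E M} (u : AdaptedFrame π)
    (g : structureGroup n k) : AdaptedFrame π where
  pt := u.pt
  frame := u.frame.map (Matrix.toLinearEquiv u.frame
    ((g : GL (Fin n ⊕ Fin k) ℝ) : Matrix (Fin n ⊕ Fin k) (Fin n ⊕ Fin k) ℝ)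
    ((Matrix.isUnit_iff_isUnit_det _).1 (Units.isUnit _)))
  vertical A := by
    have hg : ∀ i, ((g : GL (Fin n ⊕ Fin k) ℝ) : Matrix (Fin n ⊕ Fin k) (Fin n ⊕ Fin k) ℝ)
        (Sum.inl i) (Sum.inr A) = 0 := fun i => congrFun (congrFun g.2 i) A
    rw [Module.Basis.map_apply, Matrix.toLinearEquiv_apply, Matrix.toLin_self]
    simp [hg, u.vertical]

lemma AdaptedFrame.act_frame {π : FiberedManifold n k E M} (u : AdaptedFrame π)
    (g : structureGroup n k) (b : Fin n ⊕ Fin k) :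
    (u.act g).frame b = ∑ a, ((g : GL (Fin n ⊕ Fin k) ℝ) :
      Matrix (Fin n ⊕ Fin k) (Fin n ⊕ Fin k) ℝ) a b • u.frame a := by
  rw [AdaptedFrame.act, Module.Basis.map_apply, Matrix.toLinearEquiv_apply, Matrix.toLin_self]

/-- The fundamental vertical vector field `ξ^*(u) = d/dt (u · exp(t ξ)) |_{t = 0}`. -/
def fundamental {π : FiberedManifold n k E M} (ξ : structureAlgebra n k) (u : AdaptedFrame π) :
    TangentSpace 𝓘(ℝ, Model n k) u :=
  mfderiv 𝓘(ℝ, ℝ) 𝓘(ℝ, Model n k) (fun t : ℝ => u.act (groupExp (t • ξ))) 0 (1 : ℝ)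

/-- The basis element `E^i_j` of the Lie algebra: the endomorphism `r_i ↦ r_j` of `ℝ^(n+k)`,
that is, the matrix with a single entry `1` in row `j` and column `i`. -/
def E₁ (i j : Fin n) : structureAlgebra n k :=
  ⟨Matrix.single (Sum.inl j) (Sum.inl i) 1, by
    ext a B
    simp [Matrix.toBlocks₁₂, Matrix.single]⟩

/-- The basis element `E^i_A` of the Lie algebra: the endomorphism `r_i ↦ r_A`. -/
def E₂ (i : Fin n) (A : Fin k) : structureAlgebra n k :=
  ⟨Matrix.single (Sum.inr A) (Sum.inl i) 1, by
    ext a B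
    simp [Matrix.toBlocks₁₂, Matrix.single]⟩

/-- The basis element `E^A_B` of the Lie algebra: the endomorphism `r_A ↦ r_B`. -/
def E₃ (A B : Fin k) : structureAlgebra n k :=
  ⟨Matrix.single (Sum.inr B) (Sum.inr A) 1, by
    ext a C
    simp [Matrix.toBlocks₁₂, Matrix.single]⟩

/-! ### Forms on `L_π E` -/

/-- Differential `1`-forms on `L_π E`. -/
abbrev OneForm (π : FiberedManifold n k E M) : Type _ :=
  ∀ u : AdaptedFrame π, TangentSpace 𝓘(ℝ, Model n k) u →L[ℝ] ℝ

/-- Vector-valued `1`-forms (tensor fields of type `(1, 1)`) on `L_π E`. -/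
abbrev VectorOneForm (π : FiberedManifold n k E M) : Type _ :=
  ∀ u : AdaptedFrame π, TangentSpace 𝓘(ℝ, Model n k) u →L[ℝ] TangentSpace 𝓘(ℝ, Model n k) u

/-- The differential `d f` of a function on `L_π E`. -/
def d {π : FiberedManifold n k E M} (f : AdaptedFrame π → ℝ) : OneForm π :=
  fun u => mfderiv 𝓘(ℝ, Model n k) 𝓘(ℝ, ℝ) f u

/-- The derivation `ι_J` of degree `0`, on functions: it vanishes. -/
def ι₀ {π : FiberedManifold n k E M} (_J : VectorOneForm π) (_f : AdaptedFrame π → ℝ) :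
    AdaptedFrame π → ℝ := 0

/-- The derivation `ι_J` of degree `0`, on `1`-forms: `(ι_J η)(X) = η(J X)`. -/
def ι₁ {π : FiberedManifold n k E M} (J : VectorOneForm π) (η : OneForm π) : OneForm π :=
  fun u => (η u).comp (J u)

/-- The graded commutator `d_J = [ι_J, d] = ι_J d - d ι_J` (`ι_J` has degree `0`), on functions. -/
def dAlong {π : FiberedManifold n k E M} (J : VectorOneForm π) (f : AdaptedFrame π → ℝ) :
    OneForm π :=
  ι₁ J (d f) - d (ι₀ J f)

instance (e : E) : FiniteDimensional ℝ (TangentSpace (𝓡 (n + k)) e) :=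
  inferInstanceAs (FiniteDimensional ℝ (EuclideanSpace ℝ (Fin (n + k))))

instance (e : E) : T2Space (TangentSpace (𝓡 (n + k)) e) :=
  inferInstanceAs (T2Space (EuclideanSpace ℝ (Fin (n + k))))

/-- The components `θ^α` of the soldering form: `θ^α(X)` is the `α`-th component of `λ_* X` in
the frame `u`. -/
def soldering (π : FiberedManifold n k E M) (α : Fin n ⊕ Fin k) : OneForm π :=
  fun u => (LinearMap.toContinuousLinearMap (u.frame.coord α)).comp
    (mfderiv 𝓘(ℝ, Model n k) (𝓡 (n + k)) (AdaptedFrame.pt : AdaptedFrame π → E) u)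

/-- The vector-valued `1`-form `J̃^i = (1/n) E^{*i}_j ⊗ θ^j + E^{*i}_A ⊗ θ^A`. -/
def Jtilde (π : FiberedManifold n k E M) (i : Fin n) : VectorOneForm π :=
  fun u =>
    (1 / (n : ℝ)) • ∑ j : Fin n, (soldering π (Sum.inl j) u).smulRight (fundamental (E₁ i j) u) +
      ∑ A : Fin k, (soldering π (Sum.inr A) u).smulRight (fundamental (E₂ i A) u)

/-! ### Lifted Lagrangians and the Cartan-Hamilton-Poincaré forms -/

/-- A Lagrangian is lifted if `E^{*i}_j(L) = 0` and `E^{*A}_B(L) = 0`. -/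
def IsLifted {π : FiberedManifold n k E M} (L : AdaptedFrame π → ℝ) : Prop :=
  (∀ (i j : Fin n) (u : AdaptedFrame π), d L u (fundamental (E₁ i j) u) = 0) ∧
    ∀ (A B : Fin k) (u : AdaptedFrame π), d L u (fundamental (E₃ A B) u) = 0

/-- The Cartan-Hamilton-Poincaré `1`-forms `θ^α_L` for a normalisation `τ(n)`:
`θ^i_L = τ(n) L θ^i + E^{*i}_A(L) θ^A` and `θ^A_L = θ^A`. -/
def chpForm {π : FiberedManifold n k E M} (τ : ℕ → ℝ) (L : AdaptedFrame π → ℝ) :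
    Fin n ⊕ Fin k → OneForm π
  | Sum.inl i => fun u => (τ n * L u) • soldering π (Sum.inl i) u +
      ∑ A : Fin k, d L u (fundamental (E₂ i A) u) • soldering π (Sum.inr A) u
  | Sum.inr A => soldering π (Sum.inr A)

/-! ### Contravariant volumes and the function `σ` -/

/-- A contravariant volume on `M`: a nowhere vanishing smooth section `Λ` of `⋀^n TM`, locally of
the form `f_1 ∧ ... ∧ f_n` with smooth vector fields `f_i`. -/
structure ContravariantVolume (n : ℕ) (M : Type*)
    [TopologicalSpace M] [ChartedSpace (EuclideanSpace ℝ (Fin n)) M]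
    [IsManifold (𝓡 n) ∞ M] where
  /-- the value of `Λ` at a point -/
  val : ∀ x : M, ⋀[ℝ]^n (TangentSpace (𝓡 n) x)
  ne_zero : ∀ x, val x ≠ 0
  smooth : ∀ x : M, ∃ (U : Set M) (f : Fin n → ∀ y : M, TangentSpace (𝓡 n) y),
    IsOpen U ∧ x ∈ U ∧
    (∀ i, ContMDiffOn (𝓡 n) (𝓡 n).tangent ∞ (fun y => (⟨y, f i y⟩ : TangentBundle (𝓡 n) M)) U) ∧
    ∀ y ∈ U, val y = exteriorPower.ιMulti ℝ n (fun i => f i y)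

/-- The `n`-vector `ẽ_1 ∧ ... ∧ ẽ_n` at `π(e)`, where `ẽ_i = (π ∘ λ)_* e_i = π_* e_i`. -/
def baseVector {π : FiberedManifold n k E M} (u : AdaptedFrame π) :
    ⋀[ℝ]^n (TangentSpace (𝓡 n) (π.proj u.pt)) :=
  exteriorPower.ιMulti ℝ n fun i =>
    mfderiv (𝓡 (n + k)) (𝓡 n) π.proj u.pt (u.frame (Sum.inl i))

variable [IsManifold (𝓡 n) ∞ M]

lemma exists_sigma {π : FiberedManifold n k E M} (Λ : ContravariantVolume n M)
    (u : AdaptedFrame π) : ∃ s : ℝ, baseVector u = s • Λ.val (π.proj u.pt) := by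
  have h0 : Module.finrank ℝ (TangentSpace (𝓡 n) (π.proj u.pt)) = n :=
    finrank_euclideanSpace_fin
  have hfin : FiniteDimensional ℝ (TangentSpace (𝓡 n) (π.proj u.pt)) :=
    inferInstanceAs (FiniteDimensional ℝ (EuclideanSpace ℝ (Fin n)))
  have h1 : Module.finrank ℝ (⋀[ℝ]^n (TangentSpace (𝓡 n) (π.proj u.pt))) = 1 := by
    rw [exteriorPower.finrank_eq, h0, Nat.choose_self]
  obtain ⟨s, hs⟩ := exists_smul_eq_of_finrank_eq_one h1 (Λ.ne_zero (π.proj u.pt)) (baseVector u)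
  exact ⟨s, hs.symm⟩

/-- The function `σ` on `L_π E` determined by `ẽ_1 ∧ ... ∧ ẽ_n = σ(u) Λ(π(e))`. -/
def sigma {π : FiberedManifold n k E M} (Λ : ContravariantVolume n M) (u : AdaptedFrame π) : ℝ :=
  (exists_sigma Λ u).choose

lemma sigma_spec {π : FiberedManifold n k E M} (Λ : ContravariantVolume n M)
    (u : AdaptedFrame π) : baseVector u = sigma Λ u • Λ.val (π.proj u.pt) :=
  (exists_sigma Λ u).choose_spec

end

end CHP

end

/-!
The idea is that `σ` transforms under `G_V` by a character: acting by a matrix with upper left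
block `A` multiplies `π_* e_1 ∧ ... ∧ π_* e_n`, hence `σ`, by `det A`. Differentiating along
`exp (t ξ)` gives `ξ^*(σ) = tr(A_ξ) σ`, where `A_ξ` is the upper left block of `ξ`; thus
`E^{*i}_j(σ) = δ^i_j σ` and `E^{*i}_A(σ) = 0`, so that `d_{J̃^i} σ = (σ / n) θ^i`.
Since `d_{J̃^i}` is a derivation, `(1 / σ) d_{J̃^i}(σ L) = (L / n) θ^i + d_{J̃^i} L`, and
`E^{*i}_j(L) = 0` reduces the last term to `E^{*i}_A(L) θ^A`. For the smoothness of `σ`, write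
`Λ = f_1 ∧ ... ∧ f_n` near a point: in a trivialisation of `TM`, `σ` is the determinant of the
vectors `π_* e_i` divided by that of the `f_i`.
-/

noncomputable section

namespace CHP

section MatrixCalculus
open Matrix

variable {ι : Type*} [Fintype ι] [DecidableEq ι]

lemma hasDerivAt_exp_smul_apply {𝕜 : Type*} [RCLike 𝕜] (ξ : Matrix ι ι 𝕜) (t : 𝕜) (a b : ι) :
    HasDerivAt (fun s : 𝕜 => NormedSpace.exp (s • ξ) a b)
      ((NormedSpace.exp (t • ξ) * ξ) a b) t := by
  let normedRing : NormedRing (Matrix ι ι 𝕜) := Matrix.linftyOpNormedRing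
  let : NormedAlgebra 𝕜 (Matrix ι ι 𝕜) := Matrix.linftyOpNormedAlgebra
  have : @CompleteSpace (Matrix ι ι 𝕜) normedRing.toMetricSpace.toUniformSpace :=
    FiniteDimensional.complete 𝕜 _
  exact (LinearMap.toContinuousLinearMap
    (Matrix.entryLinearMap 𝕜 𝕜 a b)).hasFDerivAt.comp_hasDerivAt t (hasDerivAt_exp_smul_const ξ t)

lemma trace_adjugate_mul {R : Type*} [CommRing R] (A B : Matrix ι ι R) :
    (A.adjugate * B).trace = ∑ j, (A.updateCol j (B.col j)).det :=
  Finset.sum_congr rfl fun j _ => by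
    rw [← cramer_apply, cramer_eq_adjugate_mulVec]
    rfl

lemma hasDerivAt_det {𝕜 : Type*} [NontriviallyNormedField 𝕜] {X : 𝕜 → Matrix ι ι 𝕜}
    {X' : Matrix ι ι 𝕜} {t : 𝕜} (hX : ∀ i j, HasDerivAt (fun s => X s i j) (X' i j) t) :
    HasDerivAt (fun s => (X s).det) ((X t).adjugate * X').trace t := by
  have hcol (j : ι) : ((X t).updateCol j (X'.col j)).det =
      ∑ τ : Equiv.Perm ι, τ.sign • ((∏ i ∈ Finset.univ.erase j, X t (τ i) i) • X' (τ j) j) := by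
    rw [det_apply]
    refine Finset.sum_congr rfl fun τ _ => ?_
    rw [← Finset.prod_erase_mul _ _ (Finset.mem_univ j), updateCol_self, col_apply, smul_eq_mul,
      Finset.prod_congr rfl fun i hi => updateCol_ne (Finset.ne_of_mem_erase hi)]
  rw [trace_adjugate_mul, Finset.sum_congr rfl fun j _ => hcol j]
  simp only [det_apply]
  rw [Finset.sum_comm]
  refine HasDerivAt.fun_sum fun τ _ => ?_
  rw [← Finset.smul_sum]
  exact (HasDerivAt.fun_finsetProd fun i _ => hX (τ i) i).fun_const_smul τ.sign

lemma contMDiffAt_det {𝕜 : Type*} [NontriviallyNormedField 𝕜]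
    {E : Type*} [NormedAddCommGroup E] [NormedSpace 𝕜 E] {H : Type*} [TopologicalSpace H]
    {I : ModelWithCorners 𝕜 E H} {N : Type*} [TopologicalSpace N] [ChartedSpace H N]
    {m : WithTop ℕ∞} {X : N → Matrix ι ι 𝕜} {x : N}
    (hX : ∀ i j, ContMDiffAt I 𝓘(𝕜, 𝕜) m (fun y => X y i j) x) :
    ContMDiffAt I 𝓘(𝕜, 𝕜) m (fun y => (X y).det) x := by
  simp only [det_apply']
  exact contMDiffAt_finsetSum fun τ _ => contMDiffAt_const.mul
    (contMDiffAt_finsetProd fun i _ => hX _ _)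

end MatrixCalculus

section ExteriorPower

variable {ι : Type*} [Fintype ι] [DecidableEq ι]

lemma map_sum_smul_eq_det_smul {R V W : Type*} [CommRing R] [AddCommGroup V] [Module R V]
    [AddCommGroup W] [Module R W] (f : V [⋀^ι]→ₗ[R] W) (A : Matrix ι ι R) (v : ι → V) :
    f (fun i => ∑ j, A i j • v j) = A.det • f v := by
  let g : (ι → R) [⋀^ι]→ₗ[R] W := f.compLinearMap (Fintype.linearCombination R v)
  have h : g = (LinearMap.toSpanSingleton R W (f v)).compAlternatingMap
      Matrix.detRowAlternating := by
    refine (Pi.basisFun R ι).ext_alternating fun s hs => ?_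
    let τ : Equiv.Perm ι := Equiv.ofBijective s (Finite.injective_iff_bijective.1 hs)
    let δ : ι → ι → R := Pi.basisFun R ι
    have hδ : g δ = Matrix.detRowAlternating δ • f v := by
      have h₁ : Matrix.detRowAlternating δ = 1 := (Pi.basisFun_det (R := R) (ι := ι)) ▸
        (Pi.basisFun R ι).det_self
      have h₂ : (fun i => Fintype.linearCombination R v (δ i)) = v := by
        ext i
        simp [δ]
      rw [h₁, one_smul]
      exact congrArg f h₂
    change g (δ ∘ τ) = Matrix.detRowAlternating (δ ∘ τ) • f v
    rw [AlternatingMap.map_perm, AlternatingMap.map_perm, hδ, smul_assoc]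
  exact DFunLike.congr_fun h A

open exteriorPower Set.powersetCard in
lemma ιMulti_ne_zero_iff {K V : Type*} [Field K] [AddCommGroup V] [Module K V] {n : ℕ}
    {v : Fin n → V} : ιMulti K n v ≠ 0 ↔ LinearIndependent K v := by
  refine ⟨fun h => by_contra fun hv => h ((ιMulti K n).map_linearDependent v hv), fun hv => ?_⟩
  have h := (ιMulti_family_linearIndependent_field (n := n) hv).ne_zero
    (ofFinEmbEquiv (RelEmbedding.refl (· ≤ ·)))
  rwa [ιMulti_family, Equiv.symm_apply_apply] at h

end ExteriorPower

section VectorBundle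
open Bundle Filter Topology

variable {𝕜 : Type*} [NontriviallyNormedField 𝕜] [CompleteSpace 𝕜]
  {EB : Type*} [NormedAddCommGroup EB] [NormedSpace 𝕜 EB] {HB : Type*} [TopologicalSpace HB]
  {IB : ModelWithCorners 𝕜 EB HB} {B : Type*} [TopologicalSpace B] [ChartedSpace HB B]
  {EN : Type*} [NormedAddCommGroup EN] [NormedSpace 𝕜 EN] {HN : Type*} [TopologicalSpace HN]
  {IN : ModelWithCorners 𝕜 EN HN} {N : Type*} [TopologicalSpace N] [ChartedSpace HN N]
  {F : Type*} [NormedAddCommGroup F] [NormedSpace 𝕜 F] [FiniteDimensional 𝕜 F]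
  {V : B → Type*} [TopologicalSpace (TotalSpace F V)] [∀ x, TopologicalSpace (V x)]
  [FiberBundle F V] {m : WithTop ℕ∞} {n : ℕ} {p : N → B} {x : N}

lemma contMDiffAt_det_trivializationAt (b : Module.Basis (Fin n) 𝕜 F)
    {X : Fin n → ∀ y : N, V (p y)}
    (hX : ∀ i, ContMDiffAt IN (IB.prod 𝓘(𝕜, F)) m (fun y => (⟨p y, X i y⟩ : TotalSpace F V)) x) :
    ContMDiffAt IN 𝓘(𝕜, 𝕜) m
      (fun y => b.det fun i => (trivializationAt F V (p x) ⟨p y, X i y⟩).2) x := by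
  simp only [b.det_apply]
  refine contMDiffAt_det fun j i => ?_
  exact (LinearMap.toContinuousLinearMap (b.coord j)).contMDiff.contMDiffAt.comp x
    (contMDiffAt_totalSpace.1 (hX i)).2

variable [∀ x, AddCommGroup (V x)] [∀ x, Module 𝕜 (V x)] [VectorBundle 𝕜 F V]

open exteriorPower in
lemma contMDiffAt_of_ιMulti_eq_smul_ιMulti (hF : Module.finrank 𝕜 F = n)
    {X Y : Fin n → ∀ y : N, V (p y)} {s : N → 𝕜} (hp : ContinuousAt p x)
    (hX : ∀ i, ContMDiffAt IN (IB.prod 𝓘(𝕜, F)) m (fun y => (⟨p y, X i y⟩ : TotalSpace F V)) x)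
    (hY : ∀ i, ContMDiffAt IN (IB.prod 𝓘(𝕜, F)) m (fun y => (⟨p y, Y i y⟩ : TotalSpace F V)) x)
    (hYx : LinearIndependent 𝕜 fun i => Y i x)
    (hs : ∀ᶠ y in 𝓝 x, ιMulti 𝕜 n (fun i => X i y) = s y • ιMulti 𝕜 n (fun i => Y i y)) :
    ContMDiffAt IN 𝓘(𝕜, 𝕜) m s x := by
  let e := trivializationAt F V (p x)
  let b : Module.Basis (Fin n) 𝕜 F := Module.finBasisOfFinrankEq 𝕜 F hF
  let δ (Z : Fin n → ∀ y : N, V (p y)) (y : N) : 𝕜 := b.det fun i => (e ⟨p y, Z i y⟩).2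
  have hδ : ∀ᶠ y in 𝓝 x, δ X y = s y * δ Y y := by
    filter_upwards [hs, hp.preimage_mem_nhds (e.open_baseSet.mem_nhds
      (mem_baseSet_trivializationAt F V (p x)))] with y hy hye
    have h := congrArg
      (alternatingMapLinearEquiv (b.det.compLinearMap (e.linearMapAt 𝕜 (p y)))) hy
    simpa [δ, e.coe_linearMapAt_of_mem hye] using h
  have hδY : δ Y x ≠ 0 := by
    let T := e.linearEquivAt 𝕜 (p x) (mem_baseSet_trivializationAt F V (p x))
    have hT : LinearIndependent 𝕜 fun i => T (Y i x) := hYx.map' T.toLinearMap T.ker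
    exact ((b.is_basis_iff_det).1
      ⟨hT, hT.span_eq_top_of_card_eq_finrank' (by simp [hF])⟩).ne_zero
  have hδY' : ∀ᶠ y in 𝓝 x, δ Y y ≠ 0 :=
    (contMDiffAt_det_trivializationAt b hY).continuousAt.eventually_ne hδY
  refine ((contMDiffAt_det_trivializationAt b hX).div₀
    (contMDiffAt_det_trivializationAt b hY) hδY).congr_of_eventuallyEq ?_
  filter_upwards [hδ, hδY'] with y hy hy'
  exact eq_div_of_mul_eq hy' hy.symm

end VectorBundle

section ManifoldCalculus
open Bundle

variable {𝕜 : Type*} [NontriviallyNormedField 𝕜]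
  {E : Type*} [NormedAddCommGroup E] [NormedSpace 𝕜 E] {H : Type*} [TopologicalSpace H]
  {I : ModelWithCorners 𝕜 E H} {M : Type*} [TopologicalSpace M] [ChartedSpace H M]

lemma contMDiffOn_tangentMap_of_isOpen {E' : Type*} [NormedAddCommGroup E'] [NormedSpace 𝕜 E']
    {H' : Type*} [TopologicalSpace H'] {I' : ModelWithCorners 𝕜 E' H'} {M' : Type*}
    [TopologicalSpace M'] [ChartedSpace H' M'] [IsManifold I 1 M] [IsManifold I' 1 M']
    {f : M → M'} {s : Set M} {m r : WithTop ℕ∞} (hf : ContMDiffOn I I' r f s) (hmr : m + 1 ≤ r)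
    (hs : IsOpen s) :
    ContMDiffOn I.tangent I'.tangent m (tangentMap I I' f) (TotalSpace.proj ⁻¹' s) := by
  refine (hf.contMDiffOn_tangentMapWithin hmr hs.uniqueMDiffOn).congr fun p hp => ?_
  have hr : r ≠ 0 := (zero_lt_one.trans_le (le_add_self.trans hmr)).ne'
  exact (tangentMapWithin_eq_tangentMap (hs.uniqueMDiffOn _ hp)
    ((hf.mdifferentiableOn hr _ hp).mdifferentiableAt (hs.mem_nhds hp))).symm

lemma contMDiffAt_tangentBundle_modelSpace {F : Type*} [NormedAddCommGroup F] [NormedSpace 𝕜 F]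
    {m : WithTop ℕ∞} {f w : M → F} {x : M} (hf : ContMDiffAt I 𝓘(𝕜, F) m f x)
    (hw : ContMDiffAt I 𝓘(𝕜, F) m w x) :
    ContMDiffAt I 𝓘(𝕜, F).tangent m (fun y => (⟨f y, w y⟩ : TangentBundle 𝓘(𝕜, F) F)) x := by
  refine contMDiffAt_totalSpace.2 ⟨hf, ?_⟩
  simpa only [trivializationAt_model_space_apply] using hw

end ManifoldCalculus

section FrameBundle
open Matrix

variable {n k : ℕ} {E M : Type*}
  [TopologicalSpace E] [ChartedSpace (EuclideanSpace ℝ (Fin (n + k))) E]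
  [TopologicalSpace M] [ChartedSpace (EuclideanSpace ℝ (Fin n)) M]
  {π : FiberedManifold n k E M}

namespace AdaptedChart

/-- The velocity coordinates as a chart of the manifold `L_π E`, the frame `u₀` being a witness of
nonemptiness as in `frameChart`. -/
def velocityChart (c : AdaptedChart π) (u₀ : AdaptedFrame π) :
    OpenPartialHomeomorph (AdaptedFrame π) (Model n k) :=
  (frameAtlas π).openPartialHomeomorph (c.frameChart u₀) ⟨u₀, c, rfl⟩

lemma velocityChart_mem_maximalAtlas (c : AdaptedChart π) (u₀ : AdaptedFrame π) :
    c.velocityChart u₀ ∈ IsManifold.maximalAtlas 𝓘(ℝ, Model n k) ∞ (AdaptedFrame π) :=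
  IsManifold.subset_maximalAtlas (Set.mem_iUnion₂.2 ⟨c.frameChart u₀, ⟨u₀, c, rfl⟩, rfl⟩)

lemma frameSource_mem_nhds (c : AdaptedChart π) {u : AdaptedFrame π} (hu : u ∈ c.frameSource) :
    c.frameSource ∈ nhds u :=
  (c.velocityChart u).open_source.mem_nhds hu

lemma contMDiffAt_frameCoord (c : AdaptedChart π) {u : AdaptedFrame π} (hu : u ∈ c.frameSource) :
    ContMDiffAt 𝓘(ℝ, Model n k) 𝓘(ℝ, Model n k) ∞ c.frameCoord u :=
  contMDiffAt_of_mem_maximalAtlas (c.velocityChart_mem_maximalAtlas u) hu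

lemma mdifferentiableAt_of_frameCoord (c : AdaptedChart π) {F : Type*} [NormedAddCommGroup F]
    [NormedSpace ℝ F] {γ : F → AdaptedFrame π} {t : F} (hγ : ∀ s, γ s ∈ c.frameSource)
    (h : DifferentiableAt ℝ (fun s => c.frameCoord (γ s)) t) :
    MDifferentiableAt 𝓘(ℝ, F) 𝓘(ℝ, Model n k) γ t := by
  let φ := c.velocityChart (γ t)
  have hφ : MDifferentiableAt 𝓘(ℝ, Model n k) 𝓘(ℝ, Model n k) φ.symm (φ (γ t)) :=
    (contMDiffAt_symm_of_mem_maximalAtlas (c.velocityChart_mem_maximalAtlas (γ t))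
      (φ.map_source (hγ t))).mdifferentiableAt (by simp)
  have hγφ : γ = φ.symm ∘ fun s => c.frameCoord (γ s) :=
    funext fun s => (φ.left_inv (hγ s)).symm
  rw [hγφ]
  exact hφ.comp t h.mdifferentiableAt

lemma proj_eq_cod_symm (c : AdaptedChart π) {e : E} (he : e ∈ c.dom.source) :
    π.proj e = c.cod.symm (c.coord e).1 := by
  rw [coord, ← c.proj_eq e he, c.cod.left_inv (c.mapsTo e he)]

lemma coord_fst_mem_target (c : AdaptedChart π) {e : E} (he : e ∈ c.dom.source) :
    (c.coord e).1 ∈ c.cod.target := by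
  rw [coord, ← c.proj_eq e he]
  exact c.cod.map_source (c.mapsTo e he)

lemma contMDiffAt_cod_symm (c : AdaptedChart π) {x : EuclideanSpace ℝ (Fin n)}
    (hx : x ∈ c.cod.target) : ContMDiffAt (𝓡 n) (𝓡 n) ∞ c.cod.symm x :=
  contMDiffAt_symm_of_mem_maximalAtlas c.cod_mem hx

lemma hasMFDerivAt_proj (c : AdaptedChart π) {e : E} (he : e ∈ c.dom.source) :
    HasMFDerivAt (𝓡 (n + k)) (𝓡 n) π.proj e
      ((mfderiv (𝓡 n) (𝓡 n) c.cod.symm (c.coord e).1).comp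
        ((ContinuousLinearMap.fst ℝ _ _).comp (c.D e))) := by
  have hcod := (c.contMDiffAt_cod_symm (c.coord_fst_mem_target he)).mdifferentiableAt (by simp)
  have h : HasMFDerivAt (𝓡 (n + k)) (𝓡 n) (c.cod.symm ∘ Prod.fst ∘ c.coord) e _ :=
    hcod.hasMFDerivAt.comp e <|
      ((ContinuousLinearMap.fst ℝ _ _).hasMFDerivAt (x := c.coord e)).comp e
        (c.mdifferentiableAt_coord he).hasMFDerivAt
  exact h.congr_of_eventuallyEq <| Filter.eventuallyEq_of_mem (c.dom.open_source.mem_nhds he)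
    fun e' he' => c.proj_eq_cod_symm he'

lemma tangentMap_proj (c : AdaptedChart π) {e : E} (he : e ∈ c.dom.source)
    (v : TangentSpace (𝓡 (n + k)) e) :
    tangentMap (𝓡 (n + k)) (𝓡 n) π.proj ⟨e, v⟩ =
      tangentMap (𝓡 n) (𝓡 n) c.cod.symm ⟨(c.coord e).1, (c.D e v).1⟩ := by
  refine Bundle.TotalSpace.ext (c.proj_eq_cod_symm he) (heq_of_eq ?_)
  change mfderiv (𝓡 (n + k)) (𝓡 n) π.proj e v = _
  rw [(c.hasMFDerivAt_proj he).mfderiv]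
  rfl

end AdaptedChart

lemma surjective_mfderiv_proj (π : FiberedManifold n k E M) (e : E) :
    Function.Surjective (mfderiv (𝓡 (n + k)) (𝓡 n) π.proj e) := by
  obtain ⟨c, hc⟩ := AdaptedChart.exists_mem_source π e
  have hcod : c.cod.MDifferentiable (𝓡 n) (𝓡 n) :=
    ⟨(contMDiffOn_of_mem_maximalAtlas c.cod_mem).mdifferentiableOn (by simp),
      (contMDiffOn_symm_of_mem_maximalAtlas c.cod_mem).mdifferentiableOn (by simp)⟩
  rw [(c.hasMFDerivAt_proj hc).mfderiv]
  exact (hcod.symm.mfderiv_surjective (c.coord_fst_mem_target hc)).comp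
    (Prod.fst_surjective.comp (c.D_bijective hc).2)

lemma groupExp_zero : groupExp (0 : structureAlgebra n k) = 1 :=
  Subtype.ext (Units.ext NormedSpace.exp_zero)

namespace AdaptedFrame

lemma linearIndependent_mfderiv_proj (u : AdaptedFrame π) :
    LinearIndependent ℝ fun i : Fin n =>
      mfderiv (𝓡 (n + k)) (𝓡 n) π.proj u.pt (u.frame (Sum.inl i)) := by
  have hrank : Module.finrank ℝ (TangentSpace (𝓡 n) (π.proj u.pt)) = n :=
    finrank_euclideanSpace_fin
  refine linearIndependent_of_top_le_span_of_card_eq_finrank (fun w _ => ?_) (by simp [hrank])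
  obtain ⟨v, rfl⟩ := surjective_mfderiv_proj π u.pt w
  rw [← u.frame.sum_repr v, Fintype.sum_sum_type, map_add, map_sum, map_sum]
  simp only [map_smul, u.vertical, smul_zero, Finset.sum_const_zero, add_zero]
  exact Submodule.sum_mem _ fun i _ =>
    Submodule.smul_mem _ _ (Submodule.subset_span (Set.mem_range_self i))

lemma mfderiv_proj_act (u : AdaptedFrame π) (g : structureGroup n k) (i : Fin n) :
    mfderiv (𝓡 (n + k)) (𝓡 n) π.proj u.pt ((u.act g).frame (Sum.inl i)) =
      ∑ j, (g.1 : Matrix (Fin n ⊕ Fin k) (Fin n ⊕ Fin k) ℝ).toBlocks₁₁ᵀ i j •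
        mfderiv (𝓡 (n + k)) (𝓡 n) π.proj u.pt (u.frame (Sum.inl j)) := by
  rw [u.act_frame, map_sum, Fintype.sum_sum_type]
  simp only [map_smul, u.vertical, smul_zero, Finset.sum_const_zero, add_zero]
  rfl

lemma contMDiff_proj_pt :
    ContMDiff 𝓘(ℝ, Model n k) (𝓡 n) ∞ fun u : AdaptedFrame π => π.proj u.pt := by
  intro u
  obtain ⟨c, hc⟩ := AdaptedChart.exists_mem_source π u.pt
  have hfst : ContMDiffAt 𝓘(ℝ, Model n k) (𝓡 n) ∞ (fun v => (c.frameCoord v).1.1) u :=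
    (by fun_prop : ContDiff ℝ ∞ fun w : Model n k => w.1.1).contMDiff.contMDiffAt.comp u
      (c.contMDiffAt_frameCoord hc)
  refine ((c.contMDiffAt_cod_symm (c.coord_fst_mem_target hc)).comp u
    hfst).congr_of_eventuallyEq ?_
  exact Filter.eventuallyEq_of_mem (c.frameSource_mem_nhds hc) fun v hv => c.proj_eq_cod_symm hv

lemma contMDiff_mfderiv_proj [IsManifold (𝓡 n) 1 M] (i : Fin n) :
    ContMDiff 𝓘(ℝ, Model n k) (𝓡 n).tangent ∞ fun u : AdaptedFrame π =>
      (⟨π.proj u.pt, mfderiv (𝓡 (n + k)) (𝓡 n) π.proj u.pt (u.frame (Sum.inl i))⟩ :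
        TangentBundle (𝓡 n) M) := by
  intro u
  obtain ⟨c, hc⟩ := AdaptedChart.exists_mem_source π u.pt
  have hw : ContMDiffAt 𝓘(ℝ, Model n k) (𝓡 n).tangent ∞ (fun v : AdaptedFrame π =>
      (⟨(c.frameCoord v).1.1, ((c.frameCoord v).2.1 i).1⟩ :
        TangentBundle (𝓡 n) (EuclideanSpace ℝ (Fin n)))) u :=
    contMDiffAt_tangentBundle_modelSpace
      ((by fun_prop : ContDiff ℝ ∞ fun w : Model n k => w.1.1).contMDiff.contMDiffAt.comp u
        (c.contMDiffAt_frameCoord hc))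
      ((by fun_prop : ContDiff ℝ ∞ fun w : Model n k => (w.2.1 i).1).contMDiff.contMDiffAt.comp u
        (c.contMDiffAt_frameCoord hc))
  have hcod := contMDiffOn_tangentMap_of_isOpen (m := ∞)
    (contMDiffOn_symm_of_mem_maximalAtlas c.cod_mem) (by simp) c.cod.open_target
  have hmem := c.coord_fst_mem_target hc
  refine (ContMDiffAt.comp u (hcod.contMDiffAt ?_) hw).congr_of_eventuallyEq ?_
  · exact (c.cod.open_target.preimage (FiberBundle.continuous_proj _ _)).mem_nhds hmem
  · exact Filter.eventuallyEq_of_mem (c.frameSource_mem_nhds hc) fun v hv =>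
      c.tangentMap_proj hv _

lemma act_one (u : AdaptedFrame π) : u.act 1 = u := by
  refine AdaptedFrame.ext rfl (Module.Basis.eq_of_apply_eq fun b => ?_)
  simpa [one_apply] using! u.act_frame 1 b

lemma mdifferentiable_act_groupExp (u : AdaptedFrame π) (ξ : structureAlgebra n k) :
    MDifferentiable 𝓘(ℝ, ℝ) 𝓘(ℝ, Model n k) fun t : ℝ => u.act (groupExp (t • ξ)) := by
  intro t
  obtain ⟨c, hc⟩ := AdaptedChart.exists_mem_source π u.pt
  have hframe (b : Fin n ⊕ Fin k) : DifferentiableAt ℝ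
      (fun s : ℝ => c.D u.pt ((u.act (groupExp (s • ξ))).frame b)) t := by
    have hD (s : ℝ) : c.D u.pt ((u.act (groupExp (s • ξ))).frame b) =
        ∑ a, NormedSpace.exp (s • ξ.1) a b • c.D u.pt (u.frame a) := by
      rw [u.act_frame, map_sum]
      exact Finset.sum_congr rfl fun a _ => (c.D u.pt).map_smul _ _
    simp only [hD]
    exact DifferentiableAt.fun_sum fun a _ =>
      (hasDerivAt_exp_smul_apply _ t a b).differentiableAt.smul_const _
  refine c.mdifferentiableAt_of_frameCoord (fun _ => hc) ?_
  exact (differentiableAt_const (c.coord u.pt)).prodMk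
    ((differentiableAt_pi.2 fun i => hframe (Sum.inl i)).prodMk
      (differentiableAt_pi.2 fun A => (hframe (Sum.inr A)).snd))

lemma hasDerivAt_comp_act {f : AdaptedFrame π → ℝ} {u : AdaptedFrame π}
    (hf : MDifferentiableAt 𝓘(ℝ, Model n k) 𝓘(ℝ, ℝ) f u) (ξ : structureAlgebra n k) :
    HasDerivAt (fun t : ℝ => f (u.act (groupExp (t • ξ)))) (d f u (fundamental ξ u)) 0 := by
  have hγ := (u.mdifferentiable_act_groupExp ξ 0).hasMFDerivAt
  have hf' : HasMFDerivAt 𝓘(ℝ, Model n k) 𝓘(ℝ, ℝ) f (u.act (groupExp ((0 : ℝ) • ξ))) (d f u) := by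
    rw [zero_smul, groupExp_zero, u.act_one]
    exact hf.hasMFDerivAt
  have h : HasFDerivAt (fun t : ℝ => f (u.act (groupExp (t • ξ))))
      ((d f u).comp (mfderiv 𝓘(ℝ, ℝ) 𝓘(ℝ, Model n k)
        (fun t : ℝ => u.act (groupExp (t • ξ))) 0) : ℝ →L[ℝ] ℝ) 0 :=
    (hf'.comp 0 hγ).hasFDerivAt
  exact h.hasDerivAt

lemma baseVector_ne_zero (u : AdaptedFrame π) : baseVector u ≠ 0 :=
  ιMulti_ne_zero_iff.2 u.linearIndependent_mfderiv_proj

lemma baseVector_act (u : AdaptedFrame π) (g : structureGroup n k) :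
    baseVector (u.act g) =
      (g.1 : Matrix (Fin n ⊕ Fin k) (Fin n ⊕ Fin k) ℝ).toBlocks₁₁.det • baseVector u := by
  rw [← det_transpose, baseVector, baseVector, ← map_sum_smul_eq_det_smul]
  exact congrArg _ (funext fun i => u.mfderiv_proj_act g i)

end AdaptedFrame

lemma dAlong_apply (J : VectorOneForm π) (f : AdaptedFrame π → ℝ) (u : AdaptedFrame π)
    (X : TangentSpace 𝓘(ℝ, Model n k) u) : dAlong J f u X = d f u (J u X) := by
  have h : d (ι₀ J f) u = 0 := mfderiv_const
  change d f u (J u X) - d (ι₀ J f) u X = _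
  rw [h]
  exact sub_zero _

lemma dAlong_mul (J : VectorOneForm π) {f g : AdaptedFrame π → ℝ} {u : AdaptedFrame π}
    (hf : MDifferentiableAt 𝓘(ℝ, Model n k) 𝓘(ℝ, ℝ) f u)
    (hg : MDifferentiableAt 𝓘(ℝ, Model n k) 𝓘(ℝ, ℝ) g u) :
    dAlong J (fun v => f v * g v) u = f u • dAlong J g u + g u • dAlong J f u := by
  have h : d (fun v => f v * g v) u = f u • d g u + g u • d f u :=
    (hf.hasMFDerivAt.mul hg.hasMFDerivAt).mfderiv
  ext X
  change _ = f u * dAlong J g u X + g u * dAlong J f u X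
  rw [dAlong_apply, dAlong_apply, dAlong_apply, h]
  rfl

lemma dAlong_Jtilde (f : AdaptedFrame π → ℝ) (i : Fin n) (u : AdaptedFrame π) :
    dAlong (Jtilde π i) f u =
      (1 / (n : ℝ)) • ∑ j, d f u (fundamental (E₁ i j) u) • soldering π (Sum.inl j) u +
        ∑ A, d f u (fundamental (E₂ i A) u) • soldering π (Sum.inr A) u := by
  ext X
  rw [dAlong_apply]
  simp [Jtilde, mul_comm]

lemma trace_toBlocks₁₁_E₁ (i j : Fin n) :
    (E₁ (k := k) i j).1.toBlocks₁₁.trace = if i = j then 1 else 0 := by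
  simp [E₁, trace, toBlocks₁₁, single_apply, ite_and]

lemma trace_toBlocks₁₁_E₂ (i : Fin n) (A : Fin k) : (E₂ i A).1.toBlocks₁₁.trace = 0 := by
  simp [E₂, trace, toBlocks₁₁]

lemma chpForm_inl_eq_add_dAlong_Jtilde {L : AdaptedFrame π → ℝ} {u : AdaptedFrame π} {i : Fin n}
    (hL : ∀ j, d L u (fundamental (E₁ i j) u) = 0) :
    chpForm (fun m => 1 / (m : ℝ)) L (Sum.inl i) u =
      (L u / n) • soldering π (Sum.inl i) u + dAlong (Jtilde π i) L u := by
  simp [dAlong_Jtilde, hL, chpForm, inv_mul_eq_div]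

variable [IsManifold (𝓡 n) ∞ M] (Λ : ContravariantVolume n M)

lemma sigma_ne_zero (u : AdaptedFrame π) : sigma Λ u ≠ 0 := fun h =>
  u.baseVector_ne_zero (by rw [sigma_spec Λ u, h, zero_smul])

lemma sigma_act (u : AdaptedFrame π) (g : structureGroup n k) :
    sigma Λ (u.act g) =
      (g.1 : Matrix (Fin n ⊕ Fin k) (Fin n ⊕ Fin k) ℝ).toBlocks₁₁.det * sigma Λ u := by
  have h := u.baseVector_act g
  rw [sigma_spec Λ u, sigma_spec Λ (u.act g), smul_smul] at h
  exact smul_left_injective ℝ (Λ.ne_zero (π.proj u.pt)) h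

lemma contMDiff_sigma : ContMDiff 𝓘(ℝ, Model n k) 𝓘(ℝ, ℝ) ∞ (sigma (π := π) Λ) := by
  intro u
  obtain ⟨U, f, hU, hu, hf, hΛ⟩ := Λ.smooth (π.proj u.pt)
  have hp := AdaptedFrame.contMDiff_proj_pt (π := π) u
  refine contMDiffAt_of_ιMulti_eq_smul_ιMulti (IB := 𝓡 n) (F := EuclideanSpace ℝ (Fin n))
    (V := TangentSpace (𝓡 n)) (p := fun v => π.proj v.pt)
    (Y := fun i v => f i (π.proj v.pt)) finrank_euclideanSpace_fin hp.continuousAt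
    (fun i => AdaptedFrame.contMDiff_mfderiv_proj i u)
    (fun i => ((hf i).contMDiffAt (hU.mem_nhds hu)).comp u hp) ?_ ?_
  · exact ιMulti_ne_zero_iff.1 (hΛ _ hu ▸ Λ.ne_zero _)
  · filter_upwards [hp.continuousAt.preimage_mem_nhds (hU.mem_nhds hu)] with v hv
    rw [← hΛ _ hv]
    exact sigma_spec Λ v

lemma d_sigma_fundamental (ξ : structureAlgebra n k) (u : AdaptedFrame π) :
    d (sigma Λ) u (fundamental ξ u) = ξ.1.toBlocks₁₁.trace * sigma Λ u := by
  have hσ := AdaptedFrame.hasDerivAt_comp_act ((contMDiff_sigma Λ u).mdifferentiableAt (by simp)) ξ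
  have hdet : HasDerivAt (fun t : ℝ => (NormedSpace.exp (t • ξ.1)).toBlocks₁₁.det)
      ξ.1.toBlocks₁₁.trace 0 := by
    have hone : (1 : Matrix (Fin n ⊕ Fin k) (Fin n ⊕ Fin k) ℝ).toBlocks₁₁ = 1 := by
      rw [← fromBlocks_one, toBlocks_fromBlocks₁₁]
    refine (hasDerivAt_det (X' := ξ.1.toBlocks₁₁) fun i j => ?_).congr_deriv ?_
    · simpa using! hasDerivAt_exp_smul_apply ξ.1 0 (Sum.inl i) (Sum.inl j)
    · simp [hone]
  simp only [sigma_act] at hσ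
  exact hσ.unique (hdet.mul_const (sigma Λ u))

lemma dAlong_Jtilde_sigma (i : Fin n) (u : AdaptedFrame π) :
    dAlong (Jtilde π i) (sigma Λ) u = (sigma Λ u / n) • soldering π (Sum.inl i) u := by
  simp [dAlong_Jtilde, d_sigma_fundamental, trace_toBlocks₁₁_E₁, trace_toBlocks₁₁_E₂, smul_smul,
    inv_mul_eq_div]

end FrameBundle

end CHP

end

theorem mainTheorem7_general {n k : ℕ} {E M : Type*}
    [TopologicalSpace E] [ChartedSpace (EuclideanSpace ℝ (Fin (n + k))) E]
    [TopologicalSpace M] [ChartedSpace (EuclideanSpace ℝ (Fin n)) M] [IsManifold (𝓡 n) ∞ M]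
    (π : CHP.FiberedManifold n k E M) (Λ : CHP.ContravariantVolume n M)
    (L : CHP.AdaptedFrame π → ℝ) (hL : MDifferentiable 𝓘(ℝ, CHP.Model n k) 𝓘(ℝ, ℝ) L)
    (hlift : ∀ i j u, CHP.d L u (CHP.fundamental (CHP.E₁ i j) u) = 0) :
    (ContMDiff 𝓘(ℝ, CHP.Model n k) 𝓘(ℝ, ℝ) ∞ (CHP.sigma (π := π) Λ) ∧
      ∀ u : CHP.AdaptedFrame π, CHP.sigma Λ u ≠ 0) ∧
    ∀ (i : Fin n) (u : CHP.AdaptedFrame π),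
      CHP.chpForm (fun m => 1 / (m : ℝ)) L (Sum.inl i) u =
        (1 / CHP.sigma Λ u) •
          CHP.dAlong (CHP.Jtilde π i) (fun v => CHP.sigma Λ v * L v) u := by
  refine ⟨⟨CHP.contMDiff_sigma Λ, CHP.sigma_ne_zero Λ⟩, fun i u => ?_⟩
  have hσ := CHP.sigma_ne_zero Λ u
  rw [CHP.chpForm_inl_eq_add_dAlong_Jtilde fun j => hlift i j u,
    CHP.dAlong_mul _ ((CHP.contMDiff_sigma Λ).mdifferentiable (by simp) u) (hL u),
    CHP.dAlong_Jtilde_sigma, smul_add, smul_smul, smul_smul, smul_smul, one_div_mul_cancel hσ,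
    one_smul, add_comm]
  congr 2
  field_simp

theorem mainTheorem7 {n k : ℕ} {E M : Type*}
    [TopologicalSpace E] [ChartedSpace (EuclideanSpace ℝ (Fin (n + k))) E]
    [IsManifold (𝓡 (n + k)) ∞ E]
    [TopologicalSpace M] [ChartedSpace (EuclideanSpace ℝ (Fin n)) M] [IsManifold (𝓡 n) ∞ M]
    (π : CHP.FiberedManifold n k E M) (Λ : CHP.ContravariantVolume n M)
    (L : CHP.AdaptedFrame π → ℝ)
    (hL : ContMDiff 𝓘(ℝ, CHP.Model n k) 𝓘(ℝ, ℝ) ∞ L) (hlift : CHP.IsLifted L) :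
    (ContMDiff 𝓘(ℝ, CHP.Model n k) 𝓘(ℝ, ℝ) ∞ (CHP.sigma (π := π) Λ) ∧
      ∀ u : CHP.AdaptedFrame π, CHP.sigma Λ u ≠ 0) ∧
    ∀ (i : Fin n) (u : CHP.AdaptedFrame π),
      CHP.chpForm (fun m => 1 / (m : ℝ)) L (Sum.inl i) u =
        (1 / CHP.sigma Λ u) •
          CHP.dAlong (CHP.Jtilde π i) (fun v => CHP.sigma Λ v * L v) u :=
  mainTheorem7_general π Λ L (hL.mdifferentiable (by simp)) hlift.1
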